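/- Let $M$ be a smooth ($C^\infty$) finite-dimensional manifold without boundary, with a fixed metric $d_M$ inducing its topology. Let $\Omega\subset\mathbb{R}^m$ be a convex compact neighborhood of $0$ and let $X_0,\dots,X_m$ be $C^\infty$ vector fields on $M$. Consider the control-affine system $$\dot x(t)=X_0(x(t))+\sum_{i=1}^m u_i(t)X_i(x(t)),\qquad u\in\mathcal{U}:=\{u\in L^\infty(\mathbb{R},\mathbb{R}^m): u(t)\in\Omega\text{ for almost all }t\in\mathbb{R}\},$$ and assume that for all $u\in\mathcal{U}$ and $x\in M$ there is a unique Carathéodory solution $\varphi(t,x,u)$, $t\in\mathbb{R}$, with $\varphi(0,x,u)=x$. Endow $\mathcal{U}$ with a metric $d_{\mathcal U}$ inducing the weak$^*$ topology of $L^\infty(\mathbb{R},\mathbb{R}^m)=L^1(\mathbb{R},\mathbb{R}^m)^*$, endow $\mathcal{U}\times M$ with the metric $d((u,x),(v,y))=\max\{d_{\mathcal U}(u,v),d_M(x,y)\}$, and let $\Phi_t(u,x)=(u(t+\cdot),\varphi(t,x,u))$, $t\in\mathbb{R}$, be the control flow on $\mathcal{U}\times M$. For a metric space $X$ let $\mathcal{P}(X)$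 be the set of continuous functions $\varepsilon:X\to(0,\infty)$. A set $Y\subset\mathcal{U}\times M$ is invariant if $\Phi_t(Y)\subset Y$ for all $t\in\mathbb{R}$. It is strongly chain transitive if for all $p,q\in Y$, all $T>0$ and all $\varepsilon\in\mathcal{P}(\mathcal{U}\times M)$ there are $k\ge1$, points $p_0=p,p_1,\dots,p_k=q$ in $\mathcal{U}\times M$ and times $T_0,\dots,T_{k-1}\ge T$ with $d(\Phi_{T_j}(p_j),p_{j+1})<\varepsilon(\Phi_{T_j}(p_j))$ for $j=0,\dots,k-1$. A maximal invariant strongly chain transitive set is a set that is maximal, with respect to inclusion, among the nonempty invariant strongly chain transitive sets. A point $x\in M$ is strongly chain controllable to $y\in M$ if for all $T>0$ and all $\varepsilon\in\mathcal{P}(M)$ there are $k\ge1$, points $x_0=x,x_1,\dots,x_k=y$ in $M$, controls $u_0,\dots,u_{k-1}\in\mathcal{U}$ and times $T_0,\dots,T_{k-1}\ge T$ with $d_M(\varphi(T_j,x_j,u_j),x_{j+1})<\varepsilon(\varphi(T_j,x_j,u_j))$ for $j=0,\dots,k-1$. A nonempty set $E^*\subset M$ is a strong chain control set if (a) every $x\in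 E^*$ is strongly chain controllable to every $y\in E^*$, (b) for every $x\in E^*$ there is $u\in\mathcal{U}$ with $\varphi(t,x,u)\in E^*$ for all $t\in\mathbb{R}$, and (c) $E^*$ is maximal with these properties. Then: (i) If $E^*\subset M$ is a strong chain control set, then $$\mathcal{E}^*:=\{(u,x)\in\mathcal{U}\times M:\varphi(t,x,u)\in E^*\text{ for all }t\in\mathbb{R}\}$$ is a maximal invariant strongly chain transitive set for $\Phi$. (ii) Conversely, if $\mathcal{E}^*\subset\mathcal{U}\times M$ is a maximal invariant strongly chain transitive set for $\Phi$, then $$E^*:=\{x\in M:\text{there is }u\in\mathcal{U}\text{ with }(u,x)\in\mathcal{E}^*\}$$ is a strong chain control set. -/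

import Mathlib

open MeasureTheory Set
open scoped ENNReal Topology Manifold ContDiff

/-- The admissible controls: classes `u ∈ L^∞(ℝ, ℝ^m)` with `u(t) ∈ Ω` for almost all `t ∈ ℝ`. -/
structure Control {m : ℕ} (Ω : Set (EuclideanSpace ℝ (Fin m))) where
  toLp : Lp (EuclideanSpace ℝ (Fin m)) ∞ (volume : Measure ℝ)
  mem : ∀ᵐ t : ℝ, toLp t ∈ Ω

namespace Control

variable {m : ℕ} {Ω : Set (EuclideanSpace ℝ (Fin m))}

/-- The shifted control `u(t + ·)`. -/
noncomputable def shift (t : ℝ) (u : Control Ω) : Control Ω where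
  toLp := Lp.compMeasurePreserving (fun s : ℝ => t + s) (measurePreserving_add_left volume t) u.toLp
  mem := by
    filter_upwards [Lp.coeFn_compMeasurePreserving u.toLp (measurePreserving_add_left volume t),
      (measurePreserving_add_left (volume : Measure ℝ) t).quasiMeasurePreserving.ae u.mem]
      with s hs hm
    rw [hs]
    exact hm

/-- The trace on the set of controls of the weak-* topology of `L^∞ = (L^1)^*`: the coarsest
topology for which all maps `u ↦ ∫ ⟨u(t), y(t)⟩ dt`, `y ∈ L^1(ℝ, ℝ^m)`, are continuous. -/
noncomputable def weakStarTopology (Ω : Set (EuclideanSpace ℝ (Fin m))) :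
    TopologicalSpace (Control Ω) :=
  TopologicalSpace.induced
    (fun (u : Control Ω) (y : Lp (EuclideanSpace ℝ (Fin m)) 1 (volume : Measure ℝ)) =>
      ∫ t : ℝ, inner ℝ (u.toLp t) (y t))
    Pi.topologicalSpace

end Control

/-- A curve in a manifold is locally absolutely continuous if it is continuous and, around every
time, it is absolutely continuous in a chart. -/
def IsLocallyAbsolutelyContinuous {n : ℕ} {M : Type*} [TopologicalSpace M]
    [ChartedSpace (EuclideanSpace ℝ (Fin n)) M] (γ : ℝ → M) : Prop :=
  Continuous γ ∧ ∀ t₀ : ℝ, ∃ a b : ℝ, a < t₀ ∧ t₀ < b ∧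
    (∀ t ∈ Icc a b, γ t ∈ (chartAt (EuclideanSpace ℝ (Fin n)) (γ t₀)).source) ∧
    AbsolutelyContinuousOnInterval
      (fun t => chartAt (EuclideanSpace ℝ (Fin n)) (γ t₀) (γ t)) a b

/-- The data of a control-affine system
`x'(t) = X₀(x(t)) + ∑ i, u_i(t) X_i(x(t))`, `u(t) ∈ Ω`, on an `n`-dimensional smooth manifold. -/
structure ControlAffineSystem (n m : ℕ) (M : Type*) [TopologicalSpace M]
    [ChartedSpace (EuclideanSpace ℝ (Fin n)) M] [IsManifold (𝓡 n) ∞ M] where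
  /-- the control range -/
  Ω : Set (EuclideanSpace ℝ (Fin m))
  convex : Convex ℝ Ω
  isCompact : IsCompact Ω
  mem_nhds : Ω ∈ 𝓝 (0 : EuclideanSpace ℝ (Fin m))
  /-- the drift vector field -/
  X₀ : (x : M) → TangentSpace (𝓡 n) x
  /-- the control vector fields -/
  X : Fin m → (x : M) → TangentSpace (𝓡 n) x
  smooth_X₀ : ContMDiff (𝓡 n) (𝓡 n).tangent ∞ (fun x => (⟨x, X₀ x⟩ : TangentBundle (𝓡 n) M))
  smooth_X : ∀ i, ContMDiff (𝓡 n) (𝓡 n).tangent ∞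
    (fun x => (⟨x, X i x⟩ : TangentBundle (𝓡 n) M))

namespace ControlAffineSystem

variable {n m : ℕ} {M : Type*} [MetricSpace M] [ChartedSpace (EuclideanSpace ℝ (Fin n)) M]
  [IsManifold (𝓡 n) ∞ M]

/-- `γ : ℝ → M` is a Carathéodory solution for the control `u`. -/
def IsSolution (S : ControlAffineSystem n m M) (u : Control S.Ω) (γ : ℝ → M) : Prop :=
  IsLocallyAbsolutelyContinuous (n := n) γ ∧
    ∀ᵐ t : ℝ, HasMFDerivAt 𝓘(ℝ, ℝ) (𝓡 n) γ t
      ((1 : ℝ →L[ℝ] ℝ).smulRight (S.X₀ (γ t) + ∑ i, u.toLp t i • S.X i (γ t)))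

/-- For every control and every initial state there is a unique solution on all of `ℝ`. -/
def UniqueGlobalSolutions (S : ControlAffineSystem n m M) : Prop :=
  ∀ (u : Control S.Ω) (x : M), ∃! γ : ℝ → M, S.IsSolution u γ ∧ γ 0 = x

/-- The solution `φ(t, x, u)`. -/
noncomputable def φ (S : ControlAffineSystem n m M) (hS : S.UniqueGlobalSolutions)
    (t : ℝ) (x : M) (u : Control S.Ω) : M :=
  (hS u x).choose t

/-- The control flow `Φ_t(u, x) = (u(t + ·), φ(t, x, u))` on the product of the set of controls
and `M`. -/
noncomputable def controlFlow (S : ControlAffineSystem n m M) (hS : S.UniqueGlobalSolutions)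
    (t : ℝ) (p : Control S.Ω × M) : Control S.Ω × M :=
  (p.1.shift t, S.φ hS t p.2 p.1)

end ControlAffineSystem

/-- The jump functions on `X`: continuous functions with values in `(0, ∞)`. -/
def IsJumpFunction {X : Type*} [TopologicalSpace X] (ε : X → ℝ) : Prop :=
  Continuous ε ∧ ∀ x, 0 < ε x

/-- There is an `(ε, T)`-chain from `x` to `y` for the flow `Ψ`. -/
def HasChain {X : Type*} [MetricSpace X] (Ψ : ℝ → X → X) (ε : X → ℝ) (T : ℝ) (x y : X) : Prop :=
  ∃ (k : ℕ) (p : ℕ → X) (τ : ℕ → ℝ), 1 ≤ k ∧ p 0 = x ∧ p k = y ∧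
    ∀ j < k, T ≤ τ j ∧ dist (Ψ (τ j) (p j)) (p (j + 1)) < ε (Ψ (τ j) (p j))

/-- Strong chain transitivity of a set for the flow `Ψ`. -/
def IsStronglyChainTransitive {X : Type*} [MetricSpace X] (Ψ : ℝ → X → X) (Y : Set X) : Prop :=
  ∀ x ∈ Y, ∀ y ∈ Y, ∀ T : ℝ, 0 < T → ∀ ε : X → ℝ, IsJumpFunction ε → HasChain Ψ ε T x y

/-- The maximal nonempty invariant strongly chain transitive sets of the flow `Ψ`. -/
def IsMaximalInvariantStronglyChainTransitive {X : Type*} [MetricSpace X] (Ψ : ℝ → X → X)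
    (Y : Set X) : Prop :=
  Maximal (fun Z : Set X => Z.Nonempty ∧ IsInvariant Ψ Z ∧ IsStronglyChainTransitive Ψ Z) Y

namespace ControlAffineSystem

variable {n m : ℕ} {M : Type*} [MetricSpace M] [ChartedSpace (EuclideanSpace ℝ (Fin n)) M]
  [IsManifold (𝓡 n) ∞ M]

/-- There is a controlled `(ε, T)`-chain from `x` to `y`. -/
def HasControlledChain (S : ControlAffineSystem n m M) (hS : S.UniqueGlobalSolutions)
    (ε : M → ℝ) (T : ℝ) (x y : M) : Prop :=
  ∃ (k : ℕ) (p : ℕ → M) (u : ℕ → Control S.Ω) (τ : ℕ → ℝ), 1 ≤ k ∧ p 0 = x ∧ p k = y ∧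
    ∀ j < k, T ≤ τ j ∧
      dist (S.φ hS (τ j) (p j) (u j)) (p (j + 1)) < ε (S.φ hS (τ j) (p j) (u j))

/-- The point `x` is strongly chain controllable to the point `y`. -/
def StronglyChainControllable (S : ControlAffineSystem n m M) (hS : S.UniqueGlobalSolutions)
    (x y : M) : Prop :=
  ∀ T : ℝ, 0 < T → ∀ ε : M → ℝ, IsJumpFunction ε → S.HasControlledChain hS ε T x y

/-- Strong chain control sets. -/
def IsStrongChainControlSet (S : ControlAffineSystem n m M) (hS : S.UniqueGlobalSolutions)
    (E : Set M) : Prop :=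
  Maximal (fun F : Set M => F.Nonempty ∧
    (∀ x ∈ F, ∀ y ∈ F, S.StronglyChainControllable hS x y) ∧
    (∀ x ∈ F, ∃ u : Control S.Ω, ∀ t : ℝ, S.φ hS t x u ∈ F)) E

/-- The lift of a subset of `M` to the product of the set of controls and `M`. -/
def lift (S : ControlAffineSystem n m M) (hS : S.UniqueGlobalSolutions) (E : Set M) :
    Set (Control S.Ω × M) :=
  {p | ∀ t : ℝ, S.φ hS t p.2 p.1 ∈ E}

end ControlAffineSystem

/-!
The lift `E ↦ lift E` and the projection to `M` are monotone and exchange the two kinds of sets,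
forgetting maximality, with `E ⊆ proj (lift E)` and `L ⊆ lift (proj L)`; hence they exchange the
maximal ones. Only the strong chain transitivity of a lift needs an argument. Between two points
of `M` a controlled chain lifts to a chain without jumps in the controls: concatenate the controls
of its pieces. Since the set of controls is weak-* compact, a jump function on the product
dominates one that depends on the point of `M` only. The prescribed controls `u` and `v` at the
two ends are met at the cost of one small jump each, because controls that agree on a long
interval around `0` are weak-* close: follow `u`, and come back along `v`, for a long time.
-/

theorem disjoint_uIoc_map_of_monotoneOn {α β : Type*} [LinearOrder α] [LinearOrder β] {h : α → β}
    {s : Set α} (hm : MonotoneOn h s) {a b c d : α} (ha : a ∈ s) (hb : b ∈ s) (hc : c ∈ s)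
    (hd : d ∈ s) (hdisj : Disjoint (uIoc a b) (uIoc c d)) :
    Disjoint (uIoc (h a) (h b)) (uIoc (h c) (h d)) := by
  have hmem : ∀ {x y}, x ∈ s → y ∈ s → min x y ∈ s ∧ max x y ∈ s := fun hx hy =>
    ⟨min_rec' (· ∈ s) hx hy, max_rec' (· ∈ s) hx hy⟩
  have hmax := (hmem ha hb).2
  have hmax' := (hmem hc hd).2
  have hmin := (hmem ha hb).1
  have hmin' := (hmem hc hd).1
  rw [uIoc, uIoc, Ioc_disjoint_Ioc] at hdisj ⊢
  rw [← hm.map_max ha hb, ← hm.map_max hc hd, ← hm.map_min ha hb, ← hm.map_min hc hd,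
    ← hm.map_min hmax hmax', ← hm.map_max hmin hmin']
  exact hm (hmem hmax hmax').1 (hmem hmin hmin').2 hdisj

section AbsoluteContinuity

variable {X : Type*} [PseudoMetricSpace X] {f g : ℝ → X} {a b c d : ℝ}

theorem absolutelyContinuousOnInterval_congr (hf : AbsolutelyContinuousOnInterval f a b)
    (hfg : EqOn f g (uIcc a b)) : AbsolutelyContinuousOnInterval g a b := by
  rw [absolutelyContinuousOnInterval_iff] at hf ⊢
  intro ε hε
  obtain ⟨δ, hδ, hfδ⟩ := hf ε hε
  refine ⟨δ, hδ, fun I hI hlt => ?_⟩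
  refine (Finset.sum_congr rfl fun i hi => ?_).trans_lt (hfδ I hI hlt)
  rw [hfg (hI.1 i hi).1, hfg (hI.1 i hi).2]

theorem absolutelyContinuousOnInterval_comp_monotoneOn {h : ℝ → ℝ}
    (hf : AbsolutelyContinuousOnInterval f a b) (hh : AbsolutelyContinuousOnInterval h c d)
    (hm : MonotoneOn h (uIcc c d)) (hmaps : MapsTo h (uIcc c d) (uIcc a b)) :
    AbsolutelyContinuousOnInterval (fun t => f (h t)) c d := by
  rw [absolutelyContinuousOnInterval_iff] at hf hh ⊢
  intro ε hε
  obtain ⟨η, hη, hfη⟩ := hf ε hε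
  obtain ⟨δ, hδ, hhδ⟩ := hh η hη
  refine ⟨δ, hδ, fun I hI hlt =>
    hfη (I.1, fun i => (h (I.2 i).1, h (I.2 i).2)) ⟨fun i hi => ?_, fun i hi j hj hij => ?_⟩
      (hhδ I hI hlt)⟩
  · exact ⟨hmaps (hI.1 i hi).1, hmaps (hI.1 i hi).2⟩
  · exact disjoint_uIoc_map_of_monotoneOn hm (hI.1 i hi).1 (hI.1 i hi).2 (hI.1 j hj).1
      (hI.1 j hj).2 (hI.2 hi hj hij)

-- `if t ≤ c then f t else g t` is `f (min t c) + g (max t c) - f c`.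
theorem absolutelyContinuousOnInterval_ite {F : Type*} [SeminormedAddCommGroup F] {f g : ℝ → F}
    (hac : a ≤ c) (hcb : c ≤ b) (hf : AbsolutelyContinuousOnInterval f a c)
    (hg : AbsolutelyContinuousOnInterval g c b) (hfg : f c = g c) :
    AbsolutelyContinuousOnInterval (fun t => if t ≤ c then f t else g t) a b := by
  have hmin : AbsolutelyContinuousOnInterval (fun t => f (min t c)) a b := by
    refine absolutelyContinuousOnInterval_comp_monotoneOn hf
      (LipschitzWith.id.min_const c).lipschitzOnWith.absolutelyContinuousOnInterval
      (fun x _ y _ hxy => min_le_min_right _ hxy) fun t ht => ?_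
    rw [uIcc_of_le (hac.trans hcb)] at ht
    rw [uIcc_of_le hac]
    exact ⟨le_min ht.1 hac, min_le_right _ _⟩
  have hmax : AbsolutelyContinuousOnInterval (fun t => g (max t c)) a b := by
    refine absolutelyContinuousOnInterval_comp_monotoneOn hg
      (LipschitzWith.id.max_const c).lipschitzOnWith.absolutelyContinuousOnInterval
      (fun x _ y _ hxy => max_le_max_right _ hxy) fun t ht => ?_
    rw [uIcc_of_le (hac.trans hcb)] at ht
    rw [uIcc_of_le hcb]
    exact ⟨le_max_right _ _, max_le ht.2 hcb⟩
  have hconst : AbsolutelyContinuousOnInterval (fun _ => f c) a b :=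
    (LipschitzWith.const (f c)).lipschitzOnWith.absolutelyContinuousOnInterval
  refine absolutelyContinuousOnInterval_congr ((hmin.add hmax).sub hconst) fun t _ => ?_
  rcases le_or_gt t c with ht | ht
  · simp [ht, hfg]
  · simp [ht.le, ht.not_ge]

end AbsoluteContinuity

/-- Absolute continuity of a curve near the time `t₀`, in the chart at `γ t₀`: the local condition
in `IsLocallyAbsolutelyContinuous`, for an arbitrary normed model space `E`. -/
def IsAbsolutelyContinuousInChartAt (E : Type*) [SeminormedAddCommGroup E] {M : Type*}
    [TopologicalSpace M] [ChartedSpace E M] (γ : ℝ → M) (t₀ : ℝ) : Prop :=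
  ∃ a b : ℝ, a < t₀ ∧ t₀ < b ∧ (∀ t ∈ Icc a b, γ t ∈ (chartAt E (γ t₀)).source) ∧
    AbsolutelyContinuousOnInterval (fun t => chartAt E (γ t₀) (γ t)) a b

namespace IsAbsolutelyContinuousInChartAt

variable {E : Type*} [SeminormedAddCommGroup E] {M : Type*} [TopologicalSpace M] [ChartedSpace E M]
  {γ γ₁ γ₂ : ℝ → M} {t₀ : ℝ}

theorem congr_of_eventuallyEq (h : IsAbsolutelyContinuousInChartAt E γ₁ t₀)
    (hγ : γ₂ =ᶠ[𝓝 t₀] γ₁) : IsAbsolutelyContinuousInChartAt E γ₂ t₀ := by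
  obtain ⟨a, b, ha, hb, hsource, hac⟩ := h
  obtain ⟨a', b', -, hnhds, hsub⟩ :=
    exists_Icc_mem_subset_of_mem_nhds (Filter.inter_mem hγ (Icc_mem_nhds ha hb))
  obtain ⟨ha', hb'⟩ := Icc_mem_nhds_iff.1 hnhds
  refine ⟨a', b', ha', hb', fun t ht => ?_, ?_⟩
  · rw [(hsub ht).1, hγ.eq_of_nhds]
    exact hsource t (hsub ht).2
  · rw [hγ.eq_of_nhds]
    rw [← uIcc_of_le (ha'.trans hb').le] at hsub
    refine absolutelyContinuousOnInterval_congr (hac.mono fun t ht => ?_) fun t ht => ?_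
    · rw [uIcc_of_le (ha.trans hb).le]
      exact (hsub ht).2
    · rw [(hsub ht).1]

theorem comp_const_add {s : ℝ} (h : IsAbsolutelyContinuousInChartAt E γ (s + t₀)) :
    IsAbsolutelyContinuousInChartAt E (fun t => γ (s + t)) t₀ := by
  obtain ⟨a, b, ha, hb, hsource, hac⟩ := h
  have hmaps : MapsTo (fun t => s + t) (Icc (a - s) (b - s)) (Icc a b) := fun t ht =>
    ⟨by linarith [ht.1], by linarith [ht.2]⟩
  refine ⟨a - s, b - s, by linarith, by linarith, fun t ht => hsource _ (hmaps ht), ?_⟩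
  refine absolutelyContinuousOnInterval_comp_monotoneOn hac
    (isometry_add_left s).lipschitz.lipschitzOnWith.absolutelyContinuousOnInterval
    (fun x _ y _ hxy => add_le_add_right hxy s) ?_
  rwa [uIcc_of_le (by linarith), uIcc_of_le (by linarith)]

theorem ite (h₁ : IsAbsolutelyContinuousInChartAt E γ₁ t₀)
    (h₂ : IsAbsolutelyContinuousInChartAt E γ₂ t₀) (hγ : γ₁ t₀ = γ₂ t₀) :
    IsAbsolutelyContinuousInChartAt E (fun t => if t ≤ t₀ then γ₁ t else γ₂ t) t₀ := by
  obtain ⟨a, b₁, ha, hb₁, hsource₁, hac₁⟩ := h₁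
  obtain ⟨a₂, b, ha₂, hb, hsource₂, hac₂⟩ := h₂
  rw [← hγ] at hsource₂ hac₂
  refine ⟨a, b, ha, hb, fun t ht => ?_, ?_⟩
  · simp only [le_refl, if_true]
    split_ifs with htt
    · exact hsource₁ t ⟨ht.1, htt.trans hb₁.le⟩
    · exact hsource₂ t ⟨ha₂.le.trans (not_le.1 htt).le, ht.2⟩
  · simp only [le_refl, if_true, apply_ite (chartAt E (γ₁ t₀))]
    refine absolutelyContinuousOnInterval_ite ha.le hb.le (hac₁.mono ?_) (hac₂.mono ?_) (by rw [hγ])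
    · exact uIcc_subset_uIcc_left (by simp [uIcc_of_le, ha.le, hb₁.le, (ha.trans hb₁).le])
    · exact uIcc_subset_uIcc_right (by simp [uIcc_of_le, ha₂.le, hb.le, (ha₂.trans hb).le])

end IsAbsolutelyContinuousInChartAt

theorem isLocallyAbsolutelyContinuous_iff {n : ℕ} {M : Type*} [TopologicalSpace M]
    [ChartedSpace (EuclideanSpace ℝ (Fin n)) M] {γ : ℝ → M} :
    IsLocallyAbsolutelyContinuous (n := n) γ ↔
      Continuous γ ∧ ∀ t₀, IsAbsolutelyContinuousInChartAt (EuclideanSpace ℝ (Fin n)) γ t₀ :=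
  Iff.rfl

namespace IsLocallyAbsolutelyContinuous

variable {n : ℕ} {M : Type*} [TopologicalSpace M] [ChartedSpace (EuclideanSpace ℝ (Fin n)) M]
  {γ γ₁ γ₂ : ℝ → M}

theorem comp_const_add (h : IsLocallyAbsolutelyContinuous (n := n) γ) (s : ℝ) :
    IsLocallyAbsolutelyContinuous (n := n) (fun t => γ (s + t)) := by
  rw [isLocallyAbsolutelyContinuous_iff] at h ⊢
  exact ⟨h.1.comp (continuous_const_add s), fun t₀ => (h.2 (s + t₀)).comp_const_add⟩

theorem ite {c : ℝ} (h₁ : IsLocallyAbsolutelyContinuous (n := n) γ₁)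
    (h₂ : IsLocallyAbsolutelyContinuous (n := n) γ₂) (hc : γ₁ c = γ₂ c) :
    IsLocallyAbsolutelyContinuous (n := n) (fun t => if t ≤ c then γ₁ t else γ₂ t) := by
  rw [isLocallyAbsolutelyContinuous_iff] at h₁ h₂ ⊢
  refine ⟨h₁.1.if_le h₂.1 continuous_id continuous_const (by rintro t rfl; exact hc),
    fun t₀ => ?_⟩
  rcases lt_trichotomy t₀ c with hlt | rfl | hgt
  · refine (h₁.2 t₀).congr_of_eventuallyEq ?_
    filter_upwards [Iio_mem_nhds hlt] with t ht using if_pos (le_of_lt ht)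
  · exact (h₁.2 t₀).ite (h₂.2 t₀) hc
  · refine (h₂.2 t₀).congr_of_eventuallyEq ?_
    filter_upwards [Ioi_mem_nhds hgt] with t ht using if_neg (not_le.2 ht)

end IsLocallyAbsolutelyContinuous

namespace Control

variable {m : ℕ} {Ω : Set (EuclideanSpace ℝ (Fin m))} {u v w : Control Ω} {s s' : Set ℝ}

/-- The control given by a bounded function with values in `Ω`. -/
noncomputable def ofMemLp (f : ℝ → EuclideanSpace ℝ (Fin m)) (hf : MemLp f ∞ volume)
    (hΩ : ∀ᵐ t, f t ∈ Ω) : Control Ω where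
  toLp := hf.toLp f
  mem := by
    filter_upwards [hf.coeFn_toLp, hΩ] with t ht hmem
    rwa [ht]

theorem toLp_ofMemLp {f : ℝ → EuclideanSpace ℝ (Fin m)} (hf : MemLp f ∞ volume)
    (hΩ : ∀ᵐ t, f t ∈ Ω) : ∀ᵐ t, (ofMemLp f hf hΩ).toLp t = f t :=
  hf.coeFn_toLp

theorem ext_of_ae (h : ∀ᵐ t : ℝ, u.toLp t = v.toLp t) : u = v := by
  cases u
  cases v
  congr
  exact Lp.ext h

theorem ae_const_add {p : ℝ → Prop} (h : ∀ᵐ t : ℝ, p t) (s : ℝ) : ∀ᵐ t : ℝ, p (s + t) :=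
  (measurePreserving_add_left (volume : Measure ℝ) s).quasiMeasurePreserving.ae h

theorem toLp_shift (t : ℝ) (u : Control Ω) : ∀ᵐ r : ℝ, (u.shift t).toLp r = u.toLp (t + r) :=
  Lp.coeFn_compMeasurePreserving u.toLp (measurePreserving_add_left volume t)

@[simp]
theorem shift_zero (u : Control Ω) : u.shift 0 = u := by
  apply ext_of_ae
  filter_upwards [u.toLp_shift 0] with t ht
  rw [ht, zero_add]

@[simp]
theorem shift_shift (t r : ℝ) (u : Control Ω) : (u.shift t).shift r = u.shift (t + r) := by
  apply ext_of_ae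
  filter_upwards [(u.shift t).toLp_shift r, ae_const_add (u.toLp_shift t) r, u.toLp_shift (t + r)]
    with q h₁ h₂ h₃
  rw [h₁, h₂, h₃, add_assoc]

/-- Two controls agree on a set of times if their values coincide at almost all of these times. -/
def AgreeOn (u v : Control Ω) (s : Set ℝ) : Prop :=
  ∀ᵐ t : ℝ, t ∈ s → u.toLp t = v.toLp t

namespace AgreeOn

theorem refl (u : Control Ω) (s : Set ℝ) : u.AgreeOn u s :=
  .of_forall fun _ _ => rfl

theorem symm (h : u.AgreeOn v s) : v.AgreeOn u s :=
  Filter.Eventually.mono h fun _ ht hts => (ht hts).symm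

theorem mono (h : u.AgreeOn v s) (hs : s' ⊆ s) : u.AgreeOn v s' :=
  Filter.Eventually.mono h fun _ ht hts => ht (hs hts)

theorem trans (huv : u.AgreeOn v s) (hvw : v.AgreeOn w s) : u.AgreeOn w s := by
  filter_upwards [huv, hvw] with t huv hvw hts
  rw [huv hts, hvw hts]

theorem union (h : u.AgreeOn v s) (h' : u.AgreeOn v s') : u.AgreeOn v (s ∪ s') := by
  filter_upwards [h, h'] with t h h' hts
  exact hts.elim h h'

theorem shift (h : u.AgreeOn v s) (t : ℝ) :
    (u.shift t).AgreeOn (v.shift t) ((fun r => t + r) ⁻¹' s) := by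
  filter_upwards [u.toLp_shift t, v.toLp_shift t, ae_const_add h t] with r hu hv h hr
  rw [hu, hv, h hr]

end AgreeOn

/-- The control that follows `u` before the time `c` and `v` from the time `c` on. -/
noncomputable def concat (c : ℝ) (u v : Control Ω) : Control Ω :=
  open scoped Classical in
  ofMemLp ((Iio c).piecewise u.toLp v.toLp)
    (MemLp.piecewise measurableSet_Iio ((Lp.memLp u.toLp).restrict _)
      ((Lp.memLp v.toLp).restrict _))
    (by
      filter_upwards [u.mem, v.mem] with t hu hv
      rw [piecewise]
      split_ifs <;> assumption)

theorem concat_agreeOn_Iio (c : ℝ) (u v : Control Ω) : (concat c u v).AgreeOn u (Iio c) :=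
  (toLp_ofMemLp _ _).mono fun _ h ht => h.trans (piecewise_eq_of_mem _ _ _ ht)

theorem concat_agreeOn_Ici (c : ℝ) (u v : Control Ω) : (concat c u v).AgreeOn v (Ici c) :=
  (toLp_ofMemLp _ _).mono fun _ h ht => h.trans (piecewise_eq_of_notMem _ _ _ (notMem_Iio.2 ht))

end Control

namespace ControlAffineSystem

variable {n m : ℕ} {M : Type*} [MetricSpace M] [ChartedSpace (EuclideanSpace ℝ (Fin n)) M]
  [IsManifold (𝓡 n) ∞ M] {S : ControlAffineSystem n m M}

/-- The right-hand side of the system for the control value `w`, as a map into the model space: the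
type is thus independent of the point, so that points may be rewritten. -/
noncomputable def rhs (S : ControlAffineSystem n m M) (w : EuclideanSpace ℝ (Fin m)) (x : M) :
    EuclideanSpace ℝ (Fin n) :=
  S.X₀ x + ∑ i, w i • S.X i x

theorem hasMFDerivAt_rhs_congr {γ γ' : ℝ → M} {t : ℝ} {w : EuclideanSpace ℝ (Fin m)}
    (h : HasMFDerivAt 𝓘(ℝ, ℝ) (𝓡 n) γ t ((1 : ℝ →L[ℝ] ℝ).smulRight (S.rhs w (γ t))))
    (hγ : γ' =ᶠ[𝓝 t] γ) :
    HasMFDerivAt 𝓘(ℝ, ℝ) (𝓡 n) γ' t ((1 : ℝ →L[ℝ] ℝ).smulRight (S.rhs w (γ' t))) :=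
  (h.congr_of_eventuallyEq hγ).congr_mfderiv
    (congrArg (fun x => (1 : ℝ →L[ℝ] ℝ).smulRight (S.rhs w x)) hγ.eq_of_nhds.symm)

namespace IsSolution

theorem shift {u : Control S.Ω} {γ : ℝ → M} (h : S.IsSolution u γ) (s : ℝ) :
    S.IsSolution (u.shift s) (fun t => γ (s + t)) := by
  refine ⟨h.1.comp_const_add s, ?_⟩
  filter_upwards [u.toLp_shift s, Control.ae_const_add h.2 s] with t hu ht
  have hadd : HasMFDerivAt 𝓘(ℝ, ℝ) 𝓘(ℝ, ℝ) (fun t : ℝ => s + t) t (ContinuousLinearMap.id ℝ ℝ) :=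
    ((hasFDerivAt_id t).const_add s).hasMFDerivAt
  rw [hu]
  exact HasMFDerivAt.comp t ht hadd

theorem ite {u u₁ u₂ : Control S.Ω} {γ₁ γ₂ : ℝ → M} {c : ℝ}
    (h₁ : S.IsSolution u₁ γ₁) (h₂ : S.IsSolution u₂ γ₂) (hc : γ₁ c = γ₂ c)
    (hu₁ : u.AgreeOn u₁ (Iio c)) (hu₂ : u.AgreeOn u₂ (Ioi c)) :
    S.IsSolution u (fun t => if t ≤ c then γ₁ t else γ₂ t) := by
  refine ⟨h₁.1.ite h₂.1 hc, ?_⟩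
  filter_upwards [h₁.2, h₂.2, hu₁, hu₂, Measure.ae_ne volume c]
    with t hd₁ hd₂ hu₁ hu₂ hne
  rcases lt_or_gt_of_ne hne with hlt | hgt
  · rw [hu₁ hlt]
    refine hasMFDerivAt_rhs_congr hd₁ ?_
    filter_upwards [Iio_mem_nhds hlt] with r hr using if_pos (le_of_lt hr)
  · rw [hu₂ hgt]
    refine hasMFDerivAt_rhs_congr hd₂ ?_
    filter_upwards [Ioi_mem_nhds hgt] with r hr using if_neg (not_le.2 hr)

theorem eq_φ (hS : S.UniqueGlobalSolutions) {u : Control S.Ω} {γ : ℝ → M} (h : S.IsSolution u γ)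
    (t : ℝ) : γ t = S.φ hS t (γ 0) u :=
  congrFun ((hS u (γ 0)).choose_spec.2 γ ⟨h, rfl⟩) t

end IsSolution

variable (hS : S.UniqueGlobalSolutions)

theorem isSolution_φ (x : M) (u : Control S.Ω) : S.IsSolution u (fun t => S.φ hS t x u) :=
  (hS u x).choose_spec.1.1

@[simp]
theorem φ_zero (x : M) (u : Control S.Ω) : S.φ hS 0 x u = x :=
  (hS u x).choose_spec.1.2

@[simp]
theorem φ_φ_shift (s t : ℝ) (x : M) (u : Control S.Ω) :
    S.φ hS t (S.φ hS s x u) (u.shift s) = S.φ hS (s + t) x u := by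
  simpa only [add_zero] using (((isSolution_φ hS x u).shift s).eq_φ hS t).symm

include hS in
theorem exists_isSolution_eq (s : ℝ) (x : M) (u : Control S.Ω) :
    ∃ γ, S.IsSolution u γ ∧ γ s = x :=
  ⟨fun t => S.φ hS (-s + t) x (u.shift s), by
    simpa using (isSolution_φ hS x (u.shift s)).shift (-s), by simp⟩

-- A solution for `v` on `(-∞, b]` continued by one for `u`, inserted after the time `0` into the
-- solution for `u`, is again a solution for `u`.
theorem φ_congr {b : ℝ} (hb : 0 ≤ b) (x : M) {u v : Control S.Ω} (huv : u.AgreeOn v (Ioo 0 b)) :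
    S.φ hS b x u = S.φ hS b x v := by
  rcases hb.eq_or_lt with rfl | hb
  · simp only [φ_zero]
  obtain ⟨γ, hγ, hγb⟩ := exists_isSolution_eq hS b (S.φ hS b x v) u
  have hv := Control.concat_agreeOn_Iio b v u
  have hu := Control.concat_agreeOn_Ici b v u
  have hw : S.IsSolution (Control.concat b v u) (fun t => if t ≤ b then S.φ hS t x v else γ t) :=
    (isSolution_φ hS x v).ite hγ hγb.symm hv (hu.mono Ioi_subset_Ici_self)
  have huw : u.AgreeOn (Control.concat b v u) (Ioi 0) := by
    rw [← Ioo_union_Ici_eq_Ioi hb]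
    exact (huv.trans (hv.symm.mono Ioo_subset_Iio_self)).union hu.symm
  have hsol := (isSolution_φ hS x u).ite hw (c := 0) (by simp [hb.le]) (.refl u _) huw
  simpa [hb.not_ge] using (hsol.eq_φ hS b).symm

end ControlAffineSystem

section WeakLimits

open Filter

variable {ι H : Type*} [NormedAddCommGroup H] [InnerProductSpace ℝ H] [CompleteSpace H] {x : ι → H}

theorem exists_tendsto_inner_of_norm_le (F : Ultrafilter ι) {B : ℝ} (hB : ∀ i, ‖x i‖ ≤ B) :
    ∃ a, ∀ y, Tendsto (fun i => inner ℝ (x i) y) F (𝓝 (inner ℝ a y)) := by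
  let D : ι → WeakDual ℝ H := fun i => StrongDual.toWeakDual (InnerProductSpace.toDual ℝ H (x i))
  have hD : ∀ i, D i ∈ WeakDual.toStrongDual ⁻¹' Metric.closedBall (0 : StrongDual ℝ H) B := by
    intro i
    rw [mem_preimage, mem_closedBall_zero_iff]
    exact ((InnerProductSpace.toDual ℝ H).norm_map (x i)).trans_le (hB i)
  obtain ⟨l, -, hl⟩ := (WeakDual.isCompact_closedBall (𝕜 := ℝ) (0 : StrongDual ℝ H) B)
    |>.ultrafilter_le_nhds (F.map D) (tendsto_principal.2 (Eventually.of_forall hD))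
  refine ⟨(InnerProductSpace.toDual ℝ H).symm (WeakDual.toStrongDual l), fun y => ?_⟩
  rw [InnerProductSpace.toDual_symm_apply]
  exact ((WeakDual.eval_continuous y).tendsto l).comp (show Tendsto D F (𝓝 l) from hl)

theorem mem_of_tendsto_inner {l : Filter ι} [l.NeBot] {K : Set H} (hconv : Convex ℝ K)
    (hclosed : IsClosed K) (hx : ∀ i, x i ∈ K) {a : H}
    (ha : ∀ y, Tendsto (fun i => inner ℝ (x i) y) l (𝓝 (inner ℝ a y))) : a ∈ K := by
  by_contra haK
  obtain ⟨φ, s, hs, hsa⟩ := geometric_hahn_banach_closed_point hconv hclosed haK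
  have hφ : ∀ z, φ z = inner ℝ z ((InnerProductSpace.toDual ℝ H).symm φ) := fun z => by
    rw [real_inner_comm, InnerProductSpace.toDual_symm_apply]
  have hlim : Tendsto (fun i => φ (x i)) l (𝓝 (φ a)) := by
    simpa only [← hφ] using ha ((InnerProductSpace.toDual ℝ H).symm φ)
  exact hsa.not_ge (le_of_tendsto hlim (Eventually.of_forall fun i => (hs _ (hx i)).le))

end WeakLimits

section WeakStarCompactness

open Filter

variable {α E : Type*} [MeasurableSpace α] {μ : Measure α} [NormedAddCommGroup E] {Ω : Set E}

theorem convex_setOf_ae_mem [NormedSpace ℝ E] (hΩ : Convex ℝ Ω) (p : ℝ≥0∞) :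
    Convex ℝ {f : Lp E p μ | ∀ᵐ t ∂μ, f t ∈ Ω} := by
  intro f hf g hg a b ha hb hab
  filter_upwards [hf, hg, Lp.coeFn_add (a • f) (b • g), Lp.coeFn_smul a f, Lp.coeFn_smul b g]
    with t hft hgt hadd hsf hsg
  rw [hadd, Pi.add_apply, hsf, hsg]
  exact hΩ hft hgt ha hb hab

theorem isClosed_setOf_ae_mem (hΩ : IsClosed Ω) (p : ℝ≥0∞) [Fact (1 ≤ p)] :
    IsClosed {f : Lp E p μ | ∀ᵐ t ∂μ, f t ∈ Ω} := by
  refine IsSeqClosed.isClosed fun f f₀ hf hlim => ?_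
  obtain ⟨ns, -, hns⟩ := (tendstoInMeasure_of_tendsto_Lp hlim).exists_seq_tendsto_ae
  filter_upwards [ae_all_iff.2 hf, hns] with t hft ht
  exact hΩ.mem_of_tendsto ht (Eventually.of_forall fun i => hft _)

theorem exists_simpleFunc_integral_norm_sub_lt {y : α → E} (hy : Integrable y μ) {ε : ℝ}
    (hε : 0 < ε) : ∃ s : SimpleFunc α E, Integrable s μ ∧ ∫ t, ‖y t - s t‖ ∂μ < ε := by
  obtain ⟨s, hys, hs⟩ := (memLp_one_iff_integrable.2 hy).exists_simpleFunc_eLpNorm_sub_lt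
    ENNReal.one_ne_top (ENNReal.ofReal_pos.2 hε).ne'
  rw [memLp_one_iff_integrable] at hs
  refine ⟨s, hs, ?_⟩
  rwa [eLpNorm_one_eq_lintegral_enorm, ← ofReal_integral_norm_eq_lintegral_enorm (hy.sub hs),
    ENNReal.ofReal_lt_ofReal_iff hε] at hys

variable [InnerProductSpace ℝ E] {f g y z : α → E} {C : ℝ}

theorem integrable_inner_of_norm_le (hf : AEStronglyMeasurable f μ) (hC : ∀ᵐ t ∂μ, ‖f t‖ ≤ C)
    (hy : Integrable y μ) : Integrable (fun t => inner ℝ (f t) (y t)) μ := by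
  refine (hy.norm.const_mul C).mono' (hf.inner hy.1) ?_
  filter_upwards [hC] with t ht
  exact (norm_inner_le_norm _ _).trans (by gcongr)

theorem dist_integral_inner_le (hf : AEStronglyMeasurable f μ) (hC : ∀ᵐ t ∂μ, ‖f t‖ ≤ C)
    (hy : Integrable y μ) (hz : Integrable z μ) :
    dist (∫ t, inner ℝ (f t) (y t) ∂μ) (∫ t, inner ℝ (f t) (z t) ∂μ) ≤
      C * ∫ t, ‖y t - z t‖ ∂μ := by
  rw [dist_eq_norm, ← integral_sub (integrable_inner_of_norm_le hf hC hy)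
    (integrable_inner_of_norm_le hf hC hz), ← integral_const_mul]
  refine norm_integral_le_of_norm_le ((hy.sub hz).norm.const_mul C) ?_
  filter_upwards [hC] with t ht
  rw [← inner_sub_right]
  exact (norm_inner_le_norm _ _).trans (by gcongr)

theorem tendsto_integral_inner_of_simpleFunc {ι : Type*} {l : Filter ι} {f : ι → α → E}
    (hC : 0 < C) (hf : ∀ i, AEStronglyMeasurable (f i) μ) (hfC : ∀ i, ∀ᵐ t ∂μ, ‖f i t‖ ≤ C)
    (hg : AEStronglyMeasurable g μ) (hgC : ∀ᵐ t ∂μ, ‖g t‖ ≤ C)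
    (hlim : ∀ s : SimpleFunc α E, Integrable s μ →
      Tendsto (fun i => ∫ t, inner ℝ (f i t) (s t) ∂μ) l (𝓝 (∫ t, inner ℝ (g t) (s t) ∂μ)))
    (hy : Integrable y μ) :
    Tendsto (fun i => ∫ t, inner ℝ (f i t) (y t) ∂μ) l (𝓝 (∫ t, inner ℝ (g t) (y t) ∂μ)) := by
  refine Metric.tendsto_nhds.2 fun ε hε => ?_
  obtain ⟨s, hs, hys⟩ :=
    exists_simpleFunc_integral_norm_sub_lt hy (show 0 < ε / (3 * C) by positivity)
  have hys' : C * ∫ t, ‖y t - s t‖ ∂μ < ε / 3 := by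
    rw [lt_div_iff₀ (by positivity)] at hys
    linarith
  filter_upwards [Metric.tendsto_nhds.1 (hlim s hs) (ε / 3) (by positivity)] with i hi
  have hfys := dist_integral_inner_le (hf i) (hfC i) hy hs
  have hgys := dist_integral_inner_le hg hgC hy hs
  rw [dist_comm] at hgys
  linarith [dist_triangle4 (∫ t, inner ℝ (f i t) (y t) ∂μ) (∫ t, inner ℝ (f i t) (s t) ∂μ)
    (∫ t, inner ℝ (g t) (s t) ∂μ) (∫ t, inner ℝ (g t) (y t) ∂μ)]

variable [CompleteSpace E] {ι : Type*} (F : Ultrafilter ι) {f : ι → α → E}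

theorem exists_tendsto_integral_inner_of_isFiniteMeasure [IsFiniteMeasure μ] (hconv : Convex ℝ Ω)
    (hclosed : IsClosed Ω) (hbdd : Bornology.IsBounded Ω)
    (hf : ∀ i, AEStronglyMeasurable (f i) μ) (hfΩ : ∀ i, ∀ᵐ t ∂μ, f i t ∈ Ω) :
    ∃ g, AEStronglyMeasurable g μ ∧ (∀ᵐ t ∂μ, g t ∈ Ω) ∧ ∀ y, Integrable y μ →
      Tendsto (fun i => ∫ t, inner ℝ (f i t) (y t) ∂μ) F (𝓝 (∫ t, inner ℝ (g t) (y t) ∂μ)) := by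
  obtain ⟨C, hC, hΩC⟩ := hbdd.exists_pos_norm_le
  have hfC : ∀ i, ∀ᵐ t ∂μ, ‖f i t‖ ≤ C := fun i => (hfΩ i).mono fun t ht => hΩC _ ht
  have hf2 : ∀ i, MemLp (f i) 2 μ := fun i => MemLp.of_bound (hf i) C (hfC i)
  have hC2 : MemLp (fun _ => C) 2 μ := memLp_const C
  have hnorm : ∀ i, ‖(hf2 i).toLp (f i)‖ ≤ ‖hC2.toLp (fun _ => C)‖ := by
    intro i
    refine Lp.norm_le_norm_of_ae_le ?_
    filter_upwards [hfC i, (hf2 i).coeFn_toLp, hC2.coeFn_toLp] with t ht hft hCt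
    rw [hft, hCt]
    exact ht.trans (le_abs_self C)
  have hmem : ∀ i, ∀ᵐ t ∂μ, (hf2 i).toLp (f i) t ∈ Ω := fun i => by
    filter_upwards [hfΩ i, (hf2 i).coeFn_toLp] with t ht hft
    rwa [hft]
  obtain ⟨g, hg⟩ := exists_tendsto_inner_of_norm_le F hnorm
  have hgΩ : ∀ᵐ t ∂μ, g t ∈ Ω := mem_of_tendsto_inner (convex_setOf_ae_mem hconv 2)
    (isClosed_setOf_ae_mem hclosed 2) hmem hg
  refine ⟨g, Lp.aestronglyMeasurable g, hgΩ, fun y hy => tendsto_integral_inner_of_simpleFunc hC hf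
    hfC (Lp.aestronglyMeasurable g) (hgΩ.mono fun t ht => hΩC _ ht) (fun s _ => ?_) hy⟩
  have hs := s.memLp_of_isFiniteMeasure 2 μ
  have hinner : ∀ {h : α → E} {h' : Lp E 2 μ}, h' =ᵐ[μ] h →
      inner ℝ h' (hs.toLp s) = ∫ t, inner ℝ (h t) (s t) ∂μ := fun {h h'} hh => by
    rw [L2.inner_def]
    refine integral_congr_ae ?_
    filter_upwards [hh, hs.coeFn_toLp] with t ht hst
    rw [ht, hst]
  have hlim := hg (hs.toLp s)
  rw [hinner (h := g) ae_eq_rfl] at hlim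
  simpa only [fun i => hinner (hf2 i).coeFn_toLp] using hlim

theorem exists_tendsto_integral_inner [SigmaFinite μ] (hconv : Convex ℝ Ω)
    (hclosed : IsClosed Ω) (hbdd : Bornology.IsBounded Ω)
    (hf : ∀ i, AEStronglyMeasurable (f i) μ) (hfΩ : ∀ i, ∀ᵐ t ∂μ, f i t ∈ Ω) :
    ∃ g, AEStronglyMeasurable g μ ∧ (∀ᵐ t ∂μ, g t ∈ Ω) ∧ ∀ y, Integrable y μ →
      Tendsto (fun i => ∫ t, inner ℝ (f i t) (y t) ∂μ) F (𝓝 (∫ t, inner ℝ (g t) (y t) ∂μ)) := by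
  have hμν := absolutelyContinuous_toFinite μ
  have hνμ := toFinite_absolutelyContinuous μ
  obtain ⟨g, hg, hgΩ, hlim⟩ := exists_tendsto_integral_inner_of_isFiniteMeasure F hconv hclosed hbdd
    (fun i => (hf i).mono_ac hνμ) (fun i => hνμ.ae_le (hfΩ i))
  refine ⟨g, hg.mono_ac hμν, hμν.ae_le hgΩ, fun y hy => ?_⟩
  simpa only [inner_smul_right, ← smul_eq_mul, integral_rnDeriv_smul hμν] using
    hlim _ ((integrable_rnDeriv_smul_iff hμν).2 hy)

end WeakStarCompactness

namespace Control

open Filter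

variable {m : ℕ} {Ω : Set (EuclideanSpace ℝ (Fin m))}

theorem tendsto_nhds_iff [τ : TopologicalSpace (Control Ω)] (hτ : τ = weakStarTopology Ω)
    {ι : Type*} {l : Filter ι} {w : ι → Control Ω} {u : Control Ω} :
    Tendsto w l (𝓝 u) ↔ ∀ y : Lp (EuclideanSpace ℝ (Fin m)) 1 (volume : Measure ℝ),
      Tendsto (fun i => ∫ t, inner ℝ ((w i).toLp t) (y t)) l
        (𝓝 (∫ t, inner ℝ (u.toLp t) (y t))) := by
  subst hτ
  rw [weakStarTopology, nhds_induced, tendsto_comap_iff, tendsto_pi_nhds]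
  rfl

theorem compactSpace [τ : TopologicalSpace (Control Ω)] (hτ : τ = weakStarTopology Ω)
    (hconv : Convex ℝ Ω) (hcomp : IsCompact Ω) : CompactSpace (Control Ω) := by
  refine ⟨isCompact_iff_ultrafilter_le_nhds.2 fun F _ => ?_⟩
  obtain ⟨g, hg, hgΩ, hlim⟩ := exists_tendsto_integral_inner F hconv hcomp.isClosed hcomp.isBounded
    (fun u : Control Ω => Lp.aestronglyMeasurable u.toLp) fun u => u.mem
  obtain ⟨C, hC⟩ := hcomp.isBounded.exists_norm_le
  have hg' : MemLp g ∞ volume := memLp_top_of_bound hg C (hgΩ.mono fun t ht => hC _ ht)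
  refine ⟨ofMemLp g hg' hgΩ, mem_univ _,
    (tendsto_nhds_iff hτ (w := id) (l := (F : Filter (Control Ω)))).2 fun y => ?_⟩
  have heq : ∫ t, inner ℝ ((ofMemLp g hg' hgΩ).toLp t) (y t) = ∫ t, inner ℝ (g t) (y t) :=
    integral_congr_ae ((toLp_ofMemLp hg' hgΩ).mono fun t ht => by simp only [ht])
  simpa only [heq, id] using hlim y (L1.integrable_coeFn y)

theorem tendsto_of_agreeOn [τ : TopologicalSpace (Control Ω)] (hτ : τ = weakStarTopology Ω)
    (hΩ : Bornology.IsBounded Ω) {u : Control Ω} {w : ℕ → Control Ω} {R : ℕ → ℝ}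
    (hR : Tendsto R atTop atTop) (h : ∀ k, (w k).AgreeOn u (Ioo (-R k) (R k))) :
    Tendsto w atTop (𝓝 u) := by
  obtain ⟨C, hC⟩ := hΩ.exists_norm_le
  refine (tendsto_nhds_iff hτ).2 fun y => ?_
  have hy : Integrable y := L1.integrable_coeFn y
  refine tendsto_integral_of_dominated_convergence (fun t => C * ‖y t‖)
    (fun k => (Lp.aestronglyMeasurable _).inner hy.1) (hy.norm.const_mul C) (fun k => ?_) ?_
  · filter_upwards [(w k).mem] with t ht
    exact (norm_inner_le_norm _ _).trans (by gcongr; exact hC _ ht)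
  · filter_upwards [ae_all_iff.2 h] with t ht
    refine tendsto_const_nhds.congr' ?_
    filter_upwards [hR.eventually_gt_atTop |t|] with k hk
    rw [ht k (abs_lt.1 hk)]

theorem eventually_dist_lt_of_agreeOn [dU : MetricSpace (Control Ω)]
    (hdU : dU.toUniformSpace.toTopologicalSpace = weakStarTopology Ω)
    (hΩ : Bornology.IsBounded Ω) (u : Control Ω) {δ : ℝ} (hδ : 0 < δ) :
    ∀ᶠ R : ℝ in atTop, ∀ w : Control Ω, w.AgreeOn u (Ioo (-R) R) → dist w u < δ := by
  by_contra hfreq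
  obtain ⟨R, hR, hRw⟩ := exists_seq_forall_of_frequently (not_eventually.1 hfreq)
  push Not at hRw
  choose w hw hδw using hRw
  obtain ⟨k, hk⟩ := (Metric.tendsto_nhds.1 (tendsto_of_agreeOn hdU hΩ hR hw) δ hδ).exists
  exact (hδw k).not_gt hk

end Control

theorem transGen_iff_exists_seq {X : Type*} {r : X → X → Prop} {x y : X} :
    Relation.TransGen r x y ↔
      ∃ (k : ℕ) (p : ℕ → X), 1 ≤ k ∧ p 0 = x ∧ p k = y ∧ ∀ j < k, r (p j) (p (j + 1)) := by
  constructor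
  · intro h
    induction h with
    | @single y h => exact ⟨1, fun j => if j = 0 then x else y, le_rfl, rfl, rfl, by simpa using h⟩
    | @tail y z _ h ih =>
      obtain ⟨k, p, hk, hx, rfl, hp⟩ := ih
      refine ⟨k + 1, fun j => if j ≤ k then p j else z, by lia, by simpa using hx, by simp,
        fun j hj => ?_⟩
      rcases Nat.lt_succ_iff_lt_or_eq.1 hj with hlt | rfl
      · simpa [hlt.le, Nat.succ_le_of_lt hlt] using hp j hlt
      · simpa using h
  · rintro ⟨k, p, hk, rfl, rfl, hp⟩
    induction k, hk using Nat.le_induction with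
    | base => exact .single (hp 0 one_pos)
    | succ k _ ih => exact (ih fun j hj => hp j (by lia)).tail (hp k (by lia))

/-- A single step of an `(ε, T)`-chain for the flow `Ψ`. -/
def ChainStep {X : Type*} [MetricSpace X] (Ψ : ℝ → X → X) (ε : X → ℝ) (T : ℝ) (x y : X) : Prop :=
  ∃ τ, T ≤ τ ∧ dist (Ψ τ x) y < ε (Ψ τ x)

theorem chainStep_flow {X : Type*} [MetricSpace X] {Ψ : ℝ → X → X} {ε : X → ℝ} (hε : ∀ x, 0 < ε x)
    {T τ : ℝ} (hτ : T ≤ τ) (x : X) : ChainStep Ψ ε T x (Ψ τ x) :=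
  ⟨τ, hτ, by simpa only [dist_self] using hε _⟩

theorem hasChain_iff_transGen {X : Type*} [MetricSpace X] {Ψ : ℝ → X → X} {ε : X → ℝ} {T : ℝ}
    {x y : X} : HasChain Ψ ε T x y ↔ Relation.TransGen (ChainStep Ψ ε T) x y := by
  rw [transGen_iff_exists_seq]
  constructor
  · rintro ⟨k, p, τ, hk, hx, hy, h⟩
    exact ⟨k, p, hk, hx, hy, fun j hj => ⟨τ j, h j hj⟩⟩
  · rintro ⟨k, p, hk, hx, hy, h⟩
    choose! τ hτ using h
    exact ⟨k, p, τ, hk, hx, hy, hτ⟩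

theorem IsJumpFunction.exists_le_prod {X Y : Type*} [TopologicalSpace X] [TopologicalSpace Y]
    [CompactSpace X] [Nonempty X] {ε : X × Y → ℝ} (hε : IsJumpFunction ε) :
    ∃ η : Y → ℝ, IsJumpFunction η ∧ ∀ x y, η y ≤ ε (x, y) := by
  have hcont : ∀ y, Continuous fun x => ε (x, y) := fun y => hε.1.comp (.prodMk_left y)
  refine ⟨fun y => sInf ((fun x => ε (x, y)) '' univ), ⟨?_, fun y => ?_⟩, fun x y => ?_⟩
  · exact isCompact_univ.continuous_sInf (f := fun y x => ε (x, y)) (hε.1.comp continuous_swap)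
  · obtain ⟨x, -, hx⟩ := isCompact_univ.exists_sInf_image_eq univ_nonempty (hcont y).continuousOn
    exact (hε.2 _).trans_eq hx.symm
  · exact csInf_le (isCompact_univ.image (hcont y)).bddBelow ⟨x, mem_univ x, rfl⟩

theorem maximal_map {α β : Type*} [Preorder α] [Preorder β] {P : α → Prop} {Q : β → Prop}
    {f : α → β} {g : β → α} (hf : Monotone f) (hg : Monotone g) (hPQ : ∀ a, P a → Q (f a))
    (hQP : ∀ b, Q b → P (g b)) (hgf : ∀ a, P a → a ≤ g (f a)) (hfg : ∀ b, Q b → b ≤ f (g b))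
    {a : α} (ha : Maximal P a) : Maximal Q (f a) := by
  refine ⟨hPQ a ha.prop, fun b hb hab => (hfg b hb).trans (hf ?_)⟩
  exact ha.le_of_ge (hQP b hb) ((hgf a ha.prop).trans (hg hab))

namespace ControlAffineSystem

variable {n m : ℕ} {M : Type*} [MetricSpace M] [ChartedSpace (EuclideanSpace ℝ (Fin n)) M]
  [IsManifold (𝓡 n) ∞ M] {S : ControlAffineSystem n m M} {hS : S.UniqueGlobalSolutions}

/-- A single step of a controlled `(ε, T)`-chain. -/
def ControlledChainStep (S : ControlAffineSystem n m M) (hS : S.UniqueGlobalSolutions) (ε : M → ℝ)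
    (T : ℝ) (x y : M) : Prop :=
  ∃ (u : Control S.Ω) (τ : ℝ), T ≤ τ ∧ dist (S.φ hS τ x u) y < ε (S.φ hS τ x u)

theorem hasControlledChain_iff_transGen {ε : M → ℝ} {T : ℝ} {x y : M} :
    S.HasControlledChain hS ε T x y ↔ Relation.TransGen (S.ControlledChainStep hS ε T) x y := by
  rw [transGen_iff_exists_seq]
  constructor
  · rintro ⟨k, p, u, τ, hk, hx, hy, h⟩
    exact ⟨k, p, hk, hx, hy, fun j hj => ⟨u j, τ j, h j hj⟩⟩
  · rintro ⟨k, p, hk, hx, hy, h⟩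
    have : Nonempty (Control S.Ω) := ⟨(h 0 hk).choose⟩
    choose! u τ h using h
    exact ⟨k, p, u, τ, hk, hx, hy, h⟩

theorem controlFlow_eq_of_agreeOn {τ : ℝ} (hτ : 0 ≤ τ) (x : M) {u v : Control S.Ω}
    (huv : u.AgreeOn v (Ioo 0 τ)) :
    S.controlFlow hS τ (u, x) = (u.shift τ, S.φ hS τ x v) :=
  Prod.ext rfl (φ_congr hS hτ x huv)

theorem isInvariant_lift (E : Set M) : IsInvariant (S.controlFlow hS) (S.lift hS E) := by
  intro t p hp s
  simp only [controlFlow, φ_φ_shift]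
  exact hp (t + s)

variable [dU : MetricSpace (Control S.Ω)] {ε : Control S.Ω × M → ℝ} {T : ℝ}

theorem ControlledChainStep.exists_chainStep {η : M → ℝ} (hT : 0 ≤ T) (hη : ∀ x, 0 < η x)
    (hηε : ∀ u x, η x ≤ ε (u, x)) {x y : M} (h : S.ControlledChainStep hS η T x y)
    (v : Control S.Ω) :
    ∃ w : Control S.Ω, ∀ p : Control S.Ω, p.AgreeOn w (Ici 0) →
      ∃ q : Control S.Ω, q.AgreeOn v (Ici 0) ∧
        ChainStep (S.controlFlow hS) ε T (p, x) (q, y) := by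
  obtain ⟨u, τ, hτ, hdist⟩ := h
  refine ⟨.concat τ u (v.shift (-τ)), fun p hp => ⟨p.shift τ, ?_, τ, hτ, ?_⟩⟩
  · have hpv : p.AgreeOn (v.shift (-τ)) (Ici τ) :=
      (hp.mono (Ici_subset_Ici.2 (hT.trans hτ))).trans (Control.concat_agreeOn_Ici _ _ _)
    simpa using hpv.shift τ
  · have hpu : p.AgreeOn u (Ioo 0 τ) :=
      (hp.mono (Ioo_subset_Ioi_self.trans Ioi_subset_Ici_self)).trans
        ((Control.concat_agreeOn_Iio _ _ _).mono Ioo_subset_Iio_self)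
    rw [controlFlow_eq_of_agreeOn (hT.trans hτ) x hpu, Prod.dist_eq]
    simp only [dist_self]
    exact (max_lt (hη _) hdist).trans_le (hηε _ _)

-- The chain is lifted from its end backwards, since each control has to prescribe its successor.
theorem exists_transGen_chainStep {η : M → ℝ} (hT : 0 ≤ T) (hη : ∀ x, 0 < η x)
    (hηε : ∀ u x, η x ≤ ε (u, x)) {x y : M}
    (h : Relation.TransGen (S.ControlledChainStep hS η T) x y) (v : Control S.Ω) :
    ∃ w : Control S.Ω, ∀ p : Control S.Ω, p.AgreeOn w (Ici 0) →
      ∃ q : Control S.Ω, q.AgreeOn v (Ici 0) ∧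
        Relation.TransGen (ChainStep (S.controlFlow hS) ε T) (p, x) (q, y) := by
  induction h using Relation.TransGen.head_induction_on with
  | @single x h =>
    obtain ⟨w, hw⟩ := h.exists_chainStep hT hη hηε v
    refine ⟨w, fun p hp => ?_⟩
    obtain ⟨q, hq, hpq⟩ := hw p hp
    exact ⟨q, hq, .single hpq⟩
  | @head x z h _ ih =>
    obtain ⟨w', hw'⟩ := ih
    obtain ⟨w, hw⟩ := h.exists_chainStep hT hη hηε w'
    refine ⟨w, fun p hp => ?_⟩
    obtain ⟨p', hp', hpp'⟩ := hw p hp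
    obtain ⟨q, hq, hp'q⟩ := hw' p' hp'
    exact ⟨q, hq, .head hpp' hp'q⟩

theorem eventually_exists_transGen_chainStep
    (hdU : dU.toUniformSpace.toTopologicalSpace = Control.weakStarTopology S.Ω)
    (hε : ∀ p, 0 < ε p) (u : Control S.Ω) (x : M) :
    ∀ᶠ R in Filter.atTop, ∀ w : Control S.Ω, ∃ p : Control S.Ω, p.AgreeOn w (Ici 0) ∧
      Relation.TransGen (ChainStep (S.controlFlow hS) ε T) (u, x) (p, S.φ hS (T + R) x u) := by
  filter_upwards [Filter.eventually_ge_atTop T, Filter.eventually_ge_atTop 0,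
    Control.eventually_dist_lt_of_agreeOn hdU S.isCompact.isBounded (u.shift T)
      (hε (S.controlFlow hS T (u, x)))] with R hRT hR hclose w
  let p := Control.concat R (u.shift T) (w.shift (-R))
  have hpu : p.AgreeOn (u.shift T) (Iio R) := Control.concat_agreeOn_Iio _ _ _
  refine ⟨p.shift R, ?_, .tail (.single (b := (p, S.φ hS T x u)) ⟨T, le_rfl, ?_⟩) ?_⟩
  · simpa using (Control.concat_agreeOn_Ici R (u.shift T) (w.shift (-R))).shift R
  · have hdist := hclose p (hpu.mono Ioo_subset_Iio_self)
    simp only [controlFlow, Prod.dist_eq, dist_self, dist_comm _ p]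
    exact max_lt hdist (hε _)
  · have hflow := controlFlow_eq_of_agreeOn (hS := hS) hR (S.φ hS T x u)
      (hpu.mono Ioo_subset_Iio_self)
    rw [φ_φ_shift] at hflow
    exact hflow ▸ chainStep_flow hε hRT _

theorem eventually_chainStep_of_agreeOn
    (hdU : dU.toUniformSpace.toTopologicalSpace = Control.weakStarTopology S.Ω) {η : ℝ}
    (hη : 0 < η) {v : Control S.Ω} {y : M} (hηε : ∀ u, η ≤ ε (u, y)) :
    ∀ᶠ R in Filter.atTop, ∀ q : Control S.Ω, q.AgreeOn (v.shift (-R)) (Ici 0) →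
      ChainStep (S.controlFlow hS) ε T (q, S.φ hS (-R) y v) (v, y) := by
  filter_upwards [Filter.eventually_ge_atTop T, Filter.eventually_ge_atTop 0,
    Control.eventually_dist_lt_of_agreeOn hdU S.isCompact.isBounded v hη]
    with R hRT hR hclose q hq
  have hflow : S.controlFlow hS R (q, S.φ hS (-R) y v) = (q.shift R, y) := by
    rw [controlFlow_eq_of_agreeOn hR _ (hq.mono (Ioo_subset_Ioi_self.trans Ioi_subset_Ici_self)),
      φ_φ_shift, neg_add_cancel, φ_zero]
  have hqv : (q.shift R).AgreeOn v (Ici (-R)) := by simpa using hq.shift R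
  have hdist := hclose _ (hqv.mono (Ioo_subset_Ioi_self.trans Ioi_subset_Ici_self))
  refine ⟨R, hRT, ?_⟩
  rw [hflow, Prod.dist_eq]
  simp only [dist_self]
  exact (max_lt hdist hη).trans_le (hηε _)

theorem isStronglyChainTransitive_lift
    (hdU : dU.toUniformSpace.toTopologicalSpace = Control.weakStarTopology S.Ω) {E : Set M}
    (hE : ∀ x ∈ E, ∀ y ∈ E, S.StronglyChainControllable hS x y) :
    IsStronglyChainTransitive (S.controlFlow hS) (S.lift hS E) := by
  rintro ⟨u, x⟩ hx ⟨v, y⟩ hy T hT ε hε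
  have := Control.compactSpace hdU S.convex S.isCompact
  have : Nonempty (Control S.Ω) := ⟨u⟩
  obtain ⟨η, hη, hηε⟩ := hε.exists_le_prod
  obtain ⟨R, hstart, hend⟩ := ((eventually_exists_transGen_chainStep hdU hε.2 u x).and
    (eventually_chainStep_of_agreeOn hdU (hη.2 y) (hηε · y))).exists
  have hchain := hasControlledChain_iff_transGen.1 (hE _ (hx (T + R)) _ (hy (-R)) T hT η hη)
  obtain ⟨w, hw⟩ := exists_transGen_chainStep hT.le hη.2 hηε hchain (v.shift (-R))
  obtain ⟨p, hpw, hup⟩ := hstart w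
  obtain ⟨q, hqv, hpq⟩ := hw p hpw
  exact hasChain_iff_transGen.2 ((hup.trans hpq).tail (hend q hqv))

theorem stronglyChainControllable_of_mem {L : Set (Control S.Ω × M)}
    (hL : IsStronglyChainTransitive (S.controlFlow hS) L) {p q : Control S.Ω × M} (hp : p ∈ L)
    (hq : q ∈ L) : S.StronglyChainControllable hS p.2 q.2 := by
  intro T hT ε hε
  have hchain := hasChain_iff_transGen.1 (hL p hp q hq T hT (fun p => ε p.2)
    ⟨hε.1.comp continuous_snd, fun _ => hε.2 _⟩)
  exact hasControlledChain_iff_transGen.2 (hchain.lift Prod.snd fun p _ ⟨τ, hτ, hdist⟩ =>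
    ⟨p.1, τ, hτ, (le_max_right _ _).trans_lt hdist⟩)

end ControlAffineSystem

/-- The sets among which the maximal invariant strongly chain transitive sets are maximal. -/
def IsInvariantStronglyChainTransitive {X : Type*} [MetricSpace X] (Ψ : ℝ → X → X) (Y : Set X) :
    Prop :=
  Y.Nonempty ∧ IsInvariant Ψ Y ∧ IsStronglyChainTransitive Ψ Y

namespace ControlAffineSystem

variable {n m : ℕ} {M : Type*} [MetricSpace M] [ChartedSpace (EuclideanSpace ℝ (Fin n)) M]
  [IsManifold (𝓡 n) ∞ M] {S : ControlAffineSystem n m M} {hS : S.UniqueGlobalSolutions}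

/-- The sets with the properties of a strong chain control set except for maximality. -/
def IsPreStrongChainControlSet (S : ControlAffineSystem n m M) (hS : S.UniqueGlobalSolutions)
    (E : Set M) : Prop :=
  E.Nonempty ∧ (∀ x ∈ E, ∀ y ∈ E, S.StronglyChainControllable hS x y) ∧
    (∀ x ∈ E, ∃ u : Control S.Ω, ∀ t : ℝ, S.φ hS t x u ∈ E)

/-- The projection to `M` of a subset of the product of the set of controls and `M`. -/
def stateProjection (S : ControlAffineSystem n m M) (L : Set (Control S.Ω × M)) : Set M :=
  {x | ∃ u, (u, x) ∈ L}

theorem lift_mono : Monotone (S.lift hS) :=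
  fun _ _ hEF _ hp t => hEF (hp t)

theorem stateProjection_mono : Monotone S.stateProjection :=
  fun _ _ hLL' _ ⟨u, hu⟩ => ⟨u, hLL' hu⟩

theorem subset_lift_stateProjection {L : Set (Control S.Ω × M)}
    (hL : IsInvariant (S.controlFlow hS) L) : L ⊆ S.lift hS (S.stateProjection L) :=
  fun p hp t => ⟨p.1.shift t, hL t hp⟩

namespace IsPreStrongChainControlSet

variable {E : Set M}

theorem subset_stateProjection_lift (hE : S.IsPreStrongChainControlSet hS E) :
    E ⊆ S.stateProjection (S.lift hS E) :=
  hE.2.2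

theorem lift [dU : MetricSpace (Control S.Ω)]
    (hdU : dU.toUniformSpace.toTopologicalSpace = Control.weakStarTopology S.Ω)
    (hE : S.IsPreStrongChainControlSet hS E) :
    IsInvariantStronglyChainTransitive (S.controlFlow hS) (S.lift hS E) := by
  refine ⟨?_, isInvariant_lift E, isStronglyChainTransitive_lift hdU hE.2.1⟩
  obtain ⟨x, hx⟩ := hE.1
  obtain ⟨u, hu⟩ := hE.2.2 x hx
  exact ⟨(u, x), hu⟩

end IsPreStrongChainControlSet

theorem isPreStrongChainControlSet_stateProjection [MetricSpace (Control S.Ω)]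
    {L : Set (Control S.Ω × M)} (hL : IsInvariantStronglyChainTransitive (S.controlFlow hS) L) :
    S.IsPreStrongChainControlSet hS (S.stateProjection L) := by
  obtain ⟨⟨p, hp⟩, hinv, htrans⟩ := hL
  refine ⟨⟨p.2, p.1, hp⟩, ?_, ?_⟩
  · rintro x ⟨u, hu⟩ y ⟨v, hv⟩
    exact stronglyChainControllable_of_mem htrans hu hv
  · rintro x ⟨u, hu⟩
    have hux : (u, x) ∈ S.lift hS (S.stateProjection L) := subset_lift_stateProjection hinv hu
    exact ⟨u, hux⟩

end ControlAffineSystem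

theorem theorem3 {n m : ℕ} {M : Type*} [MetricSpace M]
    [ChartedSpace (EuclideanSpace ℝ (Fin n)) M] [IsManifold (𝓡 n) ∞ M]
    (S : ControlAffineSystem n m M) (hS : S.UniqueGlobalSolutions)
    [dU : MetricSpace (Control S.Ω)]
    (hdU : dU.toUniformSpace.toTopologicalSpace = Control.weakStarTopology S.Ω) :
    (∀ E : Set M, S.IsStrongChainControlSet hS E →
      IsMaximalInvariantStronglyChainTransitive (S.controlFlow hS) (S.lift hS E)) ∧
    (∀ L : Set (Control S.Ω × M),
      IsMaximalInvariantStronglyChainTransitive (S.controlFlow hS) L →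
      S.IsStrongChainControlSet hS {x : M | ∃ u : Control S.Ω, (u, x) ∈ L}) := by
  have hlift : ∀ E, S.IsPreStrongChainControlSet hS E →
      IsInvariantStronglyChainTransitive (S.controlFlow hS) (S.lift hS E) :=
    fun E hE => hE.lift hdU
  have hproj : ∀ L, IsInvariantStronglyChainTransitive (S.controlFlow hS) L →
      S.IsPreStrongChainControlSet hS (S.stateProjection L) :=
    fun L hL => ControlAffineSystem.isPreStrongChainControlSet_stateProjection hL
  have hE : ∀ E, S.IsPreStrongChainControlSet hS E → E ≤ S.stateProjection (S.lift hS E) :=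
    fun E hE => hE.subset_stateProjection_lift
  have hL : ∀ L, IsInvariantStronglyChainTransitive (S.controlFlow hS) L →
      L ≤ S.lift hS (S.stateProjection L) :=
    fun L hL => ControlAffineSystem.subset_lift_stateProjection hL.2.1
  have hmono : Monotone (S.lift hS) := ControlAffineSystem.lift_mono
  have hmono' : Monotone S.stateProjection := ControlAffineSystem.stateProjection_mono
  exact ⟨fun _ => maximal_map hmono hmono' hlift hproj hE hL,
    fun _ => maximal_map hmono' hmono hproj hlift hL hE⟩
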